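/- Let $\mathbb S^1\subset\mathbb R^2$ be the unit circle with angular coordinate $\theta$, let $R(x)=-x$ be the antipodal map, and let $\delta>0$. For finite nonnegative Borel measures $\rho_0,\rho_1$ on $\mathbb S^1$, let $\mathcal{CE}(\rho_0,\rho_1)$ be the set of triples $\mu=(\rho,\omega,\zeta)$ consisting of a finite nonnegative Borel measure $\rho$ and two finite signed Borel measures $\omega,\zeta$ on $[0,1]\times\mathbb S^1$ such that for all $\phi\in C^1([0,1]\times\mathbb S^1)$ $$\int \partial_t\phi\,d\rho+\int\partial_\theta\phi\,d\omega+\int\phi\,d\zeta=\int_{\mathbb S^1}\phi(1,\cdot)\,d\rho_1-\int_{\mathbb S^1}\phi(0,\cdot)\,d\rho_0 .$$ Let $f_\delta(r,w,z)=\frac{w^2+\delta^2z^2}{2r}$ if $r>0$, $f_\delta(0,0,0)=0$, and $f_\delta=+\infty$ otherwise. The unconstrained Wasserstein--Fisher--Rao (WFR) problem between $\rho_0$ and $\rho_1$ is to minimize $\int_{[0,1]\times\mathbb S^1} f_\delta\bigl(\tfrac{d\mu}{d\lambda}\bigr)\,d\lambda$ over $\mu\in\mathcal{CE}(\rho_0,\rho_1)$,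 where $\lambda$ is any nonnegative $\sigma$-finite measure with $\rho,\omega,\zeta\ll\lambda$ (the value does not depend on $\lambda$). Suppose that $R_*\rho_0=\rho_0$ and $R_*\rho_1=\rho_1$. Then the unconstrained WFR problem between $\rho_0$ and $\rho_1$ has a minimizer $\mu=(\rho,\omega,\zeta)$ that disintegrates in time, $\rho=dt\otimes\rho_t$, $\omega=dt\otimes\omega_t$, $\zeta=dt\otimes\zeta_t$, and is symmetric at almost every time: $R_*\rho_t=\rho_t$, $R_*\omega_t=\omega_t$ and $R_*\zeta_t=\zeta_t$ for almost every $t\in[0,1]$. In particular, this minimizer satisfies the convex-curve constraint $\int_{\mathbb S^1}x\,d\rho_t(x)=0$ for almost every $t\in[0,1]$. -/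

import Mathlib

open MeasureTheory ProbabilityTheory Set
open scoped unitInterval ENNReal

noncomputable section

namespace WFR

/-- The circle carries its Borel σ-algebra. -/
instance : MeasurableSpace Circle := borel Circle

instance : BorelSpace Circle := ⟨rfl⟩

/-- A triple `(ρ, ω, ζ)` on `[0,1] × 𝕊¹`: a finite nonnegative Borel measure (density) and two
finite signed Borel measures (momentum and source). The tangent bundle of the unit circle is
trivialized by the unit field `∂_θ`, so that the momentum is a scalar signed measure. -/
structure Path where
  ρ : FiniteMeasure (I × Circle)
  ω : SignedMeasure (I × Circle)
  ζ : SignedMeasure (I × Circle)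

/-- `φ` is of class `C¹` on `ℝ × 𝕊¹`, expressed in the angular coordinate `x = exp(iθ)`. The
functions of class `C¹` on `[0,1] × 𝕊¹` are the restrictions of these. -/
def IsC1 (φ : ℝ × Circle → ℝ) : Prop :=
  ContDiff ℝ 1 fun p : ℝ × ℝ => φ (p.1, Circle.exp p.2)

/-- The time derivative `∂_t φ`. -/
def dt (φ : ℝ × Circle → ℝ) (p : ℝ × Circle) : ℝ :=
  deriv (fun s : ℝ => φ (s, p.2)) p.1

/-- The angular derivative `∂_θ φ`, i.e. the derivative along the circle at unit speed. -/
def dθ (φ : ℝ × Circle → ℝ) (p : ℝ × Circle) : ℝ :=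
  deriv (fun s : ℝ => φ (p.1, p.2 * Circle.exp s)) 0

/-- The set `𝒞ℰ(ρ₀, ρ₁)` of triples that satisfy the continuity equation
`∂_t ρ + ∂_θ ω = ζ` in the distributional sense, with boundary values `ρ₀` and `ρ₁`. -/
def CE (ρ₀ ρ₁ : Measure Circle) : Set Path :=
  {μ | ∀ φ : ℝ × Circle → ℝ, IsC1 φ →
    (∫ p : I × Circle, dt φ ((p.1 : ℝ), p.2) ∂(μ.ρ : Measure (I × Circle))) +
      (∫ᵛ p : I × Circle, dθ φ ((p.1 : ℝ), p.2) ∂•μ.ω) +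
      (∫ᵛ p : I × Circle, φ ((p.1 : ℝ), p.2) ∂•μ.ζ) =
    (∫ x, φ (1, x) ∂ρ₁) - ∫ x, φ (0, x) ∂ρ₀}

open Classical in
/-- The infinitesimal cost `f_δ(r, w, z)`. -/
def cost (δ r w z : ℝ) : ℝ≥0∞ :=
  if 0 < r then ENNReal.ofReal ((w ^ 2 + δ ^ 2 * z ^ 2) / (2 * r))
  else if r = 0 ∧ w = 0 ∧ z = 0 then 0
  else ∞

/-- The integral `∫ f_δ(dμ/dν) dν` over `[0,1] × 𝕊¹`. -/
def energyWrt (δ : ℝ) (μ : Path) (ν : Measure (I × Circle)) : ℝ≥0∞ :=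
  ∫⁻ p, cost δ ((μ.ρ : Measure (I × Circle)).rnDeriv ν p).toReal
    (μ.ω.rnDeriv ν p) (μ.ζ.rnDeriv ν p) ∂ν

/-- The reference measure `ρ + |ω| + |ζ|`, which dominates the three measures of the triple. -/
def Path.ref (μ : Path) : Measure (I × Circle) :=
  (μ.ρ : Measure (I × Circle)) + μ.ω.totalVariation + μ.ζ.totalVariation

/-- The Wasserstein-Fisher-Rao energy of a triple. The choice of the dominating measure does not
matter, see `energyWrt_eq_energy`. -/
def energy (δ : ℝ) (μ : Path) : ℝ≥0∞ := energyWrt δ μ μ.ref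

/-- The squared distance `WFR_δ(ρ₀, ρ₁)²`. -/
def wfrSq (δ : ℝ) (ρ₀ ρ₁ : Measure Circle) : ℝ≥0∞ := ⨅ μ ∈ CE ρ₀ ρ₁, energy δ μ

/-- `μ` is a minimizer of the unconstrained problem between `ρ₀` and `ρ₁`. -/
def IsMinimizer (δ : ℝ) (ρ₀ ρ₁ : Measure Circle) (μ : Path) : Prop :=
  μ ∈ CE ρ₀ ρ₁ ∧ energy δ μ = wfrSq δ ρ₀ ρ₁

/-- `ρ = dt ⊗ ρ_t` for a Borel family `t ↦ ρ_t` of finite measures on the circle. -/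
def Disintegrates (ρ : Measure (I × Circle)) (ρt : Kernel I Circle) : Prop :=
  IsSFiniteKernel ρt ∧ (∀ t, IsFiniteMeasure (ρt t)) ∧ ρ = (volume : Measure I) ⊗ₘ ρt

/-- `s = dt ⊗ s_t` for a Borel family `t ↦ s_t` of signed measures on the circle whose total
variation is integrable in time. -/
def SignedDisintegrates (s : SignedMeasure (I × Circle)) (st : I → SignedMeasure Circle) : Prop :=
  (∀ B, MeasurableSet B → Measurable fun t => st t B) ∧
    (∫⁻ t, (st t).totalVariation univ) < ∞ ∧
    ∀ (A : Set I) (B : Set Circle), MeasurableSet A → MeasurableSet B →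
      s (A ×ˢ B) = ∫ t in A, st t B

/-- The antipodal map `R(x) = -x` of the unit circle. -/
def antipode (x : Circle) : Circle := -x

lemma measurable_antipode : Measurable antipode :=
  (continuous_neg : Continuous fun x : Circle => -x).measurable

lemma cost_mul {c : ℝ} (hc : 0 ≤ c) (δ r w z : ℝ) :
    cost δ (r * c) (w * c) (z * c) = ENNReal.ofReal c * cost δ r w z := by
  rcases hc.eq_or_lt with rfl | hc
  · simp [cost]
  · unfold cost
    by_cases hr : 0 < r
    · rw [if_pos hr, if_pos (by positivity), ← ENNReal.ofReal_mul hc.le]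
      congr 1
      field_simp
    · rw [if_neg hr, if_neg (by rw [mul_pos_iff_of_pos_right hc]; exact hr)]
      by_cases h : r = 0 ∧ w = 0 ∧ z = 0
      · simp [h]
      · rw [if_neg h, if_neg (by simpa [hc.ne'] using h),
          ENNReal.mul_top (by simpa using hc)]

lemma measurable_cost (δ : ℝ) : Measurable fun p : ℝ × ℝ × ℝ => cost δ p.1 p.2.1 p.2.2 := by
  unfold cost
  refine Measurable.ite (measurableSet_lt measurable_const measurable_fst) (by fun_prop) ?_
  refine Measurable.ite ?_ measurable_const measurable_const
  have : {p : ℝ × ℝ × ℝ | p.1 = 0 ∧ p.2.1 = 0 ∧ p.2.2 = 0} = {(0, 0, 0)} := by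
    ext ⟨a, b, c⟩; simp
  rw [this]
  exact measurableSet_singleton _

instance (μ : Path) : IsFiniteMeasure μ.ref := by
  unfold Path.ref; infer_instance

/-- The value of the energy does not depend on the dominating measure. -/
lemma energyWrt_eq_energy (δ : ℝ) (μ : Path) (ν : Measure (I × Circle)) [SigmaFinite ν]
    (hρ : (μ.ρ : Measure (I × Circle)) ≪ ν) (hω : μ.ω.totalVariation ≪ ν)
    (hζ : μ.ζ.totalVariation ≪ ν) : energyWrt δ μ ν = energy δ μ := by
  have href : μ.ref ≪ ν := (hρ.add_left hω).add_left hζ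
  have key : ∀ m : Measure (I × Circle), IsFiniteMeasure m → m ≤ μ.ref →
      ∀ᵐ p ∂ν, (m.rnDeriv ν p).toReal =
        (m.rnDeriv μ.ref p).toReal * (μ.ref.rnDeriv ν p).toReal := by
    intro m _ hm
    filter_upwards [Measure.rnDeriv_mul_rnDeriv (κ := ν) hm.absolutelyContinuous] with p hp
    rw [← hp, Pi.mul_apply, ENNReal.toReal_mul]
  have le1 : (μ.ρ : Measure (I × Circle)) ≤ μ.ref :=
    (Measure.le_add_right le_rfl).trans (Measure.le_add_right le_rfl)
  have le2 : μ.ω.totalVariation ≤ μ.ref :=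
    (Measure.le_add_left le_rfl).trans (Measure.le_add_right le_rfl)
  have le3 : μ.ζ.totalVariation ≤ μ.ref := Measure.le_add_left le_rfl
  have pos_le : ∀ s : SignedMeasure (I × Circle),
      s.toJordanDecomposition.posPart ≤ s.totalVariation := fun s => Measure.le_add_right le_rfl
  have neg_le : ∀ s : SignedMeasure (I × Circle),
      s.toJordanDecomposition.negPart ≤ s.totalVariation := fun s => Measure.le_add_left le_rfl
  have hmeas : Measurable fun p => cost δ ((μ.ρ : Measure (I × Circle)).rnDeriv μ.ref p).toReal
      (μ.ω.rnDeriv μ.ref p) (μ.ζ.rnDeriv μ.ref p) :=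
    (measurable_cost δ).comp ((Measure.measurable_rnDeriv _ _).ennreal_toReal.prodMk
      ((SignedMeasure.measurable_rnDeriv _ _).prodMk (SignedMeasure.measurable_rnDeriv _ _)))
  unfold energy energyWrt
  rw [← lintegral_rnDeriv_mul href hmeas.aemeasurable]
  refine lintegral_congr_ae ?_
  filter_upwards [key _ inferInstance le1, key _ inferInstance ((pos_le _).trans le2),
    key _ inferInstance ((neg_le _).trans le2), key _ inferInstance ((pos_le _).trans le3),
    key _ inferInstance ((neg_le _).trans le3), Measure.rnDeriv_ne_top μ.ref ν]
    with p h1 h2 h3 h4 h5 h6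
  simp only [SignedMeasure.rnDeriv_def]
  rw [h1, h2, h3, h4, h5, ← sub_mul, ← sub_mul, cost_mul ENNReal.toReal_nonneg,
    ENNReal.ofReal_toReal h6]

end WFR

end

/-!
By convex duality the energy of `(ρ, ω, ζ)` is the supremum of `∫ a dρ + ∫ b dω + ∫ c dζ` over the
continuous `(a, b, c)` with `a + (b² + c² / δ²) / 2 ≤ 0`. Hence a competitor of energy at most `E`
is a linear functional on triples of continuous functions that is bounded by `E` on this set and
satisfies the continuity equation. Such functionals are bounded at every triple, so that a
minimizing sequence converges pointwise along an ultrafilter, and as they form a convex set that is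
stable under the antipodal map, averaging a minimizer with its reflection makes it symmetric.
The Riesz representation theorems turn the minimizer into a measure `ρ` and densities `v`, `g` in
`L²(ρ)`. The continuity equation bounds the time marginal of `ρ` by a multiple of Lebesgue measure,
and this gives the disintegration in time.
-/

noncomputable section

namespace WFR

section Hilbert

variable {V H : Type*} [AddCommGroup V] [Module ℝ V] [NormedAddCommGroup H]
  [InnerProductSpace ℝ H]

lemma abs_le_of_forall_le_add_sq_div_two {e : V →ₗ[ℝ] H} {N : V →ₗ[ℝ] ℝ} {E : ℝ}
    (hN : ∀ x, N x ≤ E + ‖e x‖ ^ 2 / 2) (x : V) : |N x| ≤ √(2 * E) * ‖e x‖ := by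
  have hE : 0 ≤ E := by simpa using hN 0
  have hd : discrim (‖e x‖ ^ 2 / 2) (-N x) E ≤ 0 := discrim_le_zero fun s => by
    have := hN (s • x)
    simp only [map_smul, smul_eq_mul, norm_smul, mul_pow, Real.norm_eq_abs, sq_abs] at this
    linarith
  refine abs_le_of_sq_le_sq ?_ (by positivity)
  rw [mul_pow, Real.sq_sqrt (by positivity)]
  unfold discrim at hd
  nlinarith

lemma exists_eq_inner_of_forall_le_add_sq_div_two [CompleteSpace H] {e : V →ₗ[ℝ] H}
    (he : DenseRange e) {N : V →ₗ[ℝ] ℝ} {E : ℝ} (hN : ∀ x, N x ≤ E + ‖e x‖ ^ 2 / 2) :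
    ∃ u : H, (∀ x, N x = inner ℝ u (e x)) ∧ ‖u‖ ^ 2 / 2 ≤ E := by
  set u := (InnerProductSpace.toDual ℝ H).symm (N.extendOfNorm e)
  have hu : ∀ x, N x = inner ℝ u (e x) := fun x => by
    rw [InnerProductSpace.toDual_symm_apply]
    exact (LinearMap.extendOfNorm_eq he ⟨_, abs_le_of_forall_le_add_sq_div_two hN⟩ x).symm
  have inner_le : ∀ h : H, inner ℝ u h ≤ E + ‖h‖ ^ 2 / 2 := fun h =>
    he.induction_on h (isClosed_le (by fun_prop) (by fun_prop)) fun x => hu x ▸ hN x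
  refine ⟨u, hu, ?_⟩
  have := inner_le u
  rw [real_inner_self_eq_norm_sq] at this
  linarith

end Hilbert

section Ultrafilter

variable {ι V : Type*} [AddCommGroup V] [Module ℝ V]

lemma exists_linearMap_tendsto_of_bounded (F : Ultrafilter ι) (L : ι → V →ₗ[ℝ] ℝ)
    (hL : ∀ x, ∃ C, ∀ i, |L i x| ≤ C) :
    ∃ Λ : V →ₗ[ℝ] ℝ, ∀ x, Filter.Tendsto (fun i => L i x) F (nhds (Λ x)) := by
  have h : ∀ x, ∃ l, Filter.Tendsto (fun i => L i x) F (nhds l) := fun x => by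
    obtain ⟨C, hC⟩ := hL x
    obtain ⟨l, -, hl⟩ := (isCompact_Icc (a := -C) (b := C)).ultrafilter_le_nhds
      (F.map fun i => L i x) (Filter.le_principal_iff.2 (Filter.mem_map.2
        (Filter.univ_mem' fun i => abs_le.1 (hC i))))
    exact ⟨l, hl⟩
  choose l hl using h
  exact ⟨linearMapOfTendsto l L (tendsto_pi_nhds.2 hl), hl⟩

end Ultrafilter

section SignedMeasure

variable {X Y : Type*} [MeasurableSpace X] [MeasurableSpace Y]

lemma integral_withDensityᵥ {ν : Measure X} {w f : X → ℝ} (hw : Integrable w ν)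
    (hf : Measurable f) {C : ℝ} (hC : ∀ x, |f x| ≤ C) :
    ∫ᵛ x, f x ∂•(ν.withDensityᵥ w) = ∫ x, f x * w x ∂ν := by
  have h_part : ∀ u : X → ℝ, Integrable u ν →
      Integrable f (ν.withDensity fun x => ENNReal.ofReal (u x)) ∧
      Integrable (fun x => f x * max (u x) 0) ν ∧
      ∫ x, f x ∂(ν.withDensity fun x => ENNReal.ofReal (u x)) = ∫ x, f x * max (u x) 0 ∂ν := by
    intro u hu
    have := isFiniteMeasure_withDensity_ofReal hu.2
    refine ⟨.of_bound hf.aestronglyMeasurable C (.of_forall hC),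
      hu.pos_part.bdd_mul hf.aestronglyMeasurable (.of_forall hC), ?_⟩
    rw [integral_withDensity_eq_integral_toReal_smul₀ hu.aemeasurable.ennreal_ofReal (by simp)]
    simp [ENNReal.toReal_ofReal', mul_comm]
  obtain ⟨f_pos, fw_pos, h_pos⟩ := h_part w hw
  obtain ⟨f_neg, fw_neg, h_neg⟩ := h_part (fun x => -w x) hw.neg
  have lsmul_flip : (ContinuousLinearMap.lsmul ℝ ℝ : ℝ →L[ℝ] ℝ →L[ℝ] ℝ).flip =
      ContinuousLinearMap.lsmul ℝ ℝ := by ext; simp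
  have := isFiniteMeasure_withDensity_ofReal hw.2
  have := isFiniteMeasure_withDensity_ofReal hw.neg.2
  simp_rw [withDensityᵥ_eq_withDensity_pos_part_sub_withDensity_neg_part hw]
  rw [VectorMeasure.integral_sub_vectorMeasure (by simpa [VectorMeasure.Integrable] using f_pos)
      (by simpa [VectorMeasure.Integrable] using f_neg), ← lsmul_flip,
    VectorMeasure.integral_toSignedMeasure, VectorMeasure.integral_toSignedMeasure, h_pos]
  refine (congrArg _ h_neg).trans ?_
  rw [← integral_sub fw_pos fw_neg]
  simp_rw [← mul_sub, max_zero_sub_eq_self]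

lemma withDensityᵥ_rnDeriv {s : SignedMeasure X} {ν : Measure X} [SigmaFinite ν]
    (h : s.totalVariation ≪ ν) : ν.withDensityᵥ (s.rnDeriv ν) = s := by
  refine SignedMeasure.withDensityᵥ_rnDeriv_eq s ν ?_
  rw [SignedMeasure.absolutelyContinuous_ennreal_iff]
  rwa [show ν.toENNRealVectorMeasure.ennrealToMeasure = ν from
    VectorMeasure.equivMeasure.right_inv ν]

lemma integral_eq_integral_mul_rnDeriv {s : SignedMeasure X} {ν : Measure X} [SigmaFinite ν]
    (h : s.totalVariation ≪ ν) {f : X → ℝ} (hf : Measurable f) {C : ℝ} (hC : ∀ x, |f x| ≤ C) :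
    ∫ᵛ x, f x ∂•s = ∫ x, f x * s.rnDeriv ν x ∂ν := by
  conv_lhs => rw [← withDensityᵥ_rnDeriv h]
  exact integral_withDensityᵥ (SignedMeasure.integrable_rnDeriv s ν) hf hC

lemma map_withDensityᵥ_comp {ν : Measure X} {f : X → Y} (hf : Measurable f) {w : Y → ℝ}
    (hw : Integrable w (ν.map f)) :
    (ν.withDensityᵥ (w ∘ f)).map f = (ν.map f).withDensityᵥ w := by
  ext B hB
  rw [VectorMeasure.map_apply _ hf hB, withDensityᵥ_apply (hw.comp_measurable hf) (hf hB),
    withDensityᵥ_apply hw hB, setIntegral_map hB hw.aestronglyMeasurable hf.aemeasurable]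
  rfl

end SignedMeasure

lemma norm_sq_eq_integral {X : Type*} [MeasurableSpace X] {m : Measure X} (v : Lp ℝ 2 m) :
    ‖v‖ ^ 2 = ∫ x, v x ^ 2 ∂m := by
  rw [← real_inner_self_eq_norm_sq, L2.inner_def]
  simp [pow_two]

section CompactSpace

variable {X : Type*} [MeasurableSpace X] [TopologicalSpace X] [CompactSpace X] [BorelSpace X]

lemma integrable_continuousMap_mul (f : C(X, ℝ)) {ν : Measure X} {w : X → ℝ}
    (hw : Integrable w ν) : Integrable (fun x => f x * w x) ν :=
  hw.bdd_mul f.measurable.aestronglyMeasurable (.of_forall f.norm_coe_le_norm)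

lemma integrable_of_continuous {f : X → ℝ} (hf : Continuous f) (ν : Measure X)
    [IsFiniteMeasure ν] : Integrable f ν :=
  hf.integrable_of_hasCompactSupport (.of_compactSpace f)

lemma exists_measure_integral_eq [T2Space X] (Λ : C(X, ℝ) →ₗ[ℝ] ℝ) (hΛ : ∀ f, 0 ≤ f → 0 ≤ Λ f) :
    ∃ ρ : Measure X, IsFiniteMeasure ρ ∧ ∀ f, Λ f = ∫ x, f x ∂ρ := by
  let e : CompactlySupportedContinuousMap X ℝ →ₗ[ℝ] C(X, ℝ) :=
    { toFun := fun f => f.toContinuousMap, map_add' := fun _ _ => rfl, map_smul' := fun _ _ => rfl }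
  let Λ' : CompactlySupportedContinuousMap X ℝ →ₚ[ℝ] ℝ :=
    PositiveLinearMap.mk₀ (Λ ∘ₗ e) fun f hf => hΛ _ hf
  have : (RealRMK.rieszMeasure Λ').Regular := inferInstance
  exact ⟨RealRMK.rieszMeasure Λ', inferInstance, fun f => (RealRMK.integral_rieszMeasure Λ'
    (CompactlySupportedContinuousMap.continuousMapEquiv f)).symm⟩

lemma le_of_forall_integral_le [T2Space X] [HasOuterApproxClosed X] {m n : Measure X}
    [IsFiniteMeasure m] [IsFiniteMeasure n]
    (h : ∀ f : C(X, ℝ), 0 ≤ f → ∫ x, f x ∂m ≤ ∫ x, f x ∂n) : m ≤ n := by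
  let Λ : C(X, ℝ) →ₗ[ℝ] ℝ :=
    { toFun := fun f => ∫ x, f x ∂n - ∫ x, f x ∂m
      map_add' := fun f g => by
        simp only [ContinuousMap.add_apply]
        rw [integral_add (integrable_of_continuous f.continuous n)
            (integrable_of_continuous g.continuous n),
          integral_add (integrable_of_continuous f.continuous m)
            (integrable_of_continuous g.continuous m)]
        ring
      map_smul' := fun c f => by
        simp [integral_const_mul, mul_sub] }
  obtain ⟨d, _, hd⟩ := exists_measure_integral_eq Λ fun f hf => sub_nonneg.2 (h f hf)
  have hmd : m + d = n := ext_of_forall_integral_eq_of_IsFiniteMeasure fun f => by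
    rw [integral_add_measure (f.integrable m) (f.integrable d)]
    have : ∫ x, f x ∂n - ∫ x, f x ∂m = ∫ x, f x ∂d := hd f.toContinuousMap
    linarith
  exact hmd ▸ Measure.le_add_right le_rfl

variable {ρ : Measure X} [IsFiniteMeasure ρ]

lemma inner_toLp_left (f : C(X, ℝ)) (v : Lp ℝ 2 ρ) :
    inner ℝ v (ContinuousMap.toLp 2 ρ ℝ f) = ∫ x, f x * v x ∂ρ := by
  rw [L2.inner_def]
  refine integral_congr_ae ?_
  filter_upwards [ContinuousMap.coeFn_toLp (p := 2) (𝕜 := ℝ) ρ f] with x hx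
  rw [hx]
  simp

lemma norm_toLp_sq (f : C(X, ℝ)) : ‖ContinuousMap.toLp 2 ρ ℝ f‖ ^ 2 = ∫ x, f x ^ 2 ∂ρ := by
  rw [← real_inner_self_eq_norm_sq, ContinuousMap.inner_toLp]
  simp [pow_two]

variable [T2Space X] [SecondCountableTopology X]

lemma exists_densities {δ E : ℝ} (hδ : δ ≠ 0) (N : C(X, ℝ) × C(X, ℝ) →ₗ[ℝ] ℝ)
    (hN : ∀ b c : C(X, ℝ), N (b, c) ≤ E + ∫ x, (b x ^ 2 + c x ^ 2 / δ ^ 2) / 2 ∂ρ) :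
    ∃ v g : Lp ℝ 2 ρ, (∀ b c : C(X, ℝ), N (b, c) = ∫ x, b x * v x ∂ρ + ∫ x, c x * g x ∂ρ) ∧
      ∫ x, (v x ^ 2 + δ ^ 2 * g x ^ 2) / 2 ∂ρ ≤ E := by
  let T : C(X, ℝ) →ₗ[ℝ] Lp ℝ 2 ρ := (ContinuousMap.toLp 2 ρ ℝ : C(X, ℝ) →L[ℝ] Lp ℝ 2 ρ)
  let e : C(X, ℝ) × C(X, ℝ) →ₗ[ℝ] WithLp 2 (Lp ℝ 2 ρ × Lp ℝ 2 ρ) :=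
    (WithLp.linearEquiv 2 ℝ (Lp ℝ 2 ρ × Lp ℝ 2 ρ)).symm.toLinearMap ∘ₗ T.prodMap (δ⁻¹ • T)
  have hT : DenseRange T := ContinuousMap.toLp_denseRange ℝ ρ ℝ (by simp)
  have he : DenseRange e := by
    have hT' : DenseRange (δ⁻¹ • T) :=
      (Homeomorph.smulOfNeZero δ⁻¹ (inv_ne_zero hδ)).surjective.denseRange.comp hT
        (Homeomorph.continuous _)
    exact (WithLp.homeomorphProd 2 _ _).symm.surjective.denseRange.comp (hT.prodMap hT')
      (WithLp.homeomorphProd 2 _ _).symm.continuous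
  have e_sq : ∀ b c, ‖e (b, c)‖ ^ 2 / 2 = ∫ x, (b x ^ 2 + c x ^ 2 / δ ^ 2) / 2 ∂ρ := fun b c => by
    have sq_int : ∀ f : C(X, ℝ), Integrable (fun x => f x ^ 2) ρ :=
      fun f => integrable_of_continuous (f ^ 2).continuous ρ
    rw [WithLp.prod_norm_sq_eq_of_L2, integral_div,
      integral_add (sq_int b) ((sq_int c).div_const _), integral_div, ← norm_toLp_sq,
      ← norm_toLp_sq]
    simp [e, T, norm_smul, mul_pow, div_eq_inv_mul]
  obtain ⟨u, hu, huE⟩ := exists_eq_inner_of_forall_le_add_sq_div_two he (N := N) (E := E)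
    fun x => (e_sq x.1 x.2).symm ▸ hN x.1 x.2
  refine ⟨u.fst, δ⁻¹ • u.snd, fun b c => ?_, ?_⟩
  · rw [hu, WithLp.prod_inner_apply, ← inner_toLp_left, ← inner_toLp_left]
    simp [e, T, inner_smul_left, inner_smul_right]
  · have snd_sq : δ ^ 2 * ∫ x, (δ⁻¹ • u.snd : Lp ℝ 2 ρ) x ^ 2 ∂ρ = ‖u.snd‖ ^ 2 := by
      rw [← norm_sq_eq_integral, norm_smul, mul_pow, Real.norm_eq_abs, sq_abs]
      field_simp
    rwa [integral_div, integral_add (Lp.memLp _).integrable_sq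
      ((Lp.memLp _).integrable_sq.const_mul _), integral_const_mul, snd_sq,
      ← norm_sq_eq_integral, ← WithLp.prod_norm_sq_eq_of_L2]

lemma ae_eq_of_forall_integral_mul_eq {v w : X → ℝ} (hv : MemLp v 2 ρ) (hw : MemLp w 2 ρ)
    (h : ∀ f : C(X, ℝ), ∫ x, f x * v x ∂ρ = ∫ x, f x * w x ∂ρ) : v =ᵐ[ρ] w := by
  have hd : DenseRange (ContinuousMap.toLp 2 ρ ℝ : C(X, ℝ) → Lp ℝ 2 ρ) :=
    ContinuousMap.toLp_denseRange ℝ ρ ℝ (by simp)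
  refine (MemLp.toLp_eq_toLp_iff hv hw).1 (hd.eq_of_inner_left ℝ ?_)
  intro f
  have h_toLp : ∀ {u : X → ℝ} (hu : MemLp u 2 ρ),
      inner ℝ (hu.toLp u) (ContinuousMap.toLp 2 ρ ℝ f) = ∫ x, f x * u x ∂ρ := fun hu => by
    rw [inner_toLp_left]
    exact integral_congr_ae (hu.coeFn_toLp.mono fun x hx => by simp only [hx])
  rw [h_toLp hv, h_toLp hw, h f]

end CompactSpace

section Slice

variable {α Ω : Type*} [MeasurableSpace α] [MeasurableSpace Ω] [StandardBorelSpace Ω] [Nonempty Ω]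

/-- The slices of a finite measure `ρ` on a product along a reference measure `ν` on the first
factor. When the first marginal of `ρ` is absolutely continuous, they are the fibres `ρ_a` of the
disintegration `ρ = ν ⊗ ρ_a`. -/
def slice (ρ : Measure (α × Ω)) [IsFiniteMeasure ρ] (ν : Measure α) : Kernel α Ω :=
  ρ.condKernel.withDensity fun a _ => (ρ.fst.rnDeriv ν a).toNNReal

variable {ρ : Measure (α × Ω)} [IsFiniteMeasure ρ] {ν : Measure α}

lemma slice_apply (a : α) :
    slice ρ ν a = (ρ.fst.rnDeriv ν a).toNNReal • ρ.condKernel a := by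
  have : Measurable (Function.uncurry fun (a : α) (_ : Ω) =>
      ((ρ.fst.rnDeriv ν a).toNNReal : ℝ≥0∞)) :=
    (Measure.measurable_rnDeriv _ _).ennreal_toNNReal.coe_nnreal_ennreal.comp measurable_fst
  rw [slice, Kernel.withDensity_apply _ this, withDensity_const]
  rfl

instance : IsSFiniteKernel (slice ρ ν) :=
  Kernel.IsSFiniteKernel.withDensity _ fun _ _ => ENNReal.coe_ne_top

instance (a : α) : IsFiniteMeasure (slice ρ ν a) := by
  rw [slice_apply]; infer_instance

variable [SigmaFinite ν]

lemma compProd_slice (hρ : ρ.fst ≪ ν) : ν ⊗ₘ slice ρ ν = ρ := by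
  have := Measure.haveLebesgueDecomposition_of_sigmaFinite ρ.fst ν
  ext s hs
  conv_rhs => rw [← ρ.disintegrate ρ.condKernel]
  rw [Measure.compProd_apply hs, Measure.compProd_apply hs,
    ← lintegral_rnDeriv_mul hρ (Kernel.measurable_kernel_prodMk_left hs).aemeasurable]
  refine lintegral_congr_ae ?_
  filter_upwards [Measure.rnDeriv_ne_top ρ.fst ν] with a ha
  rw [slice_apply, Measure.smul_apply, ENNReal.smul_def, ENNReal.coe_toNNReal ha, smul_eq_mul]

lemma condKernel_map_ae_eq {f : Ω → Ω} (hf : Measurable f)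
    (hρ : MeasurePreserving (Prod.map id f) ρ ρ) :
    ∀ᵐ a ∂ρ.fst, (ρ.condKernel a).map f = ρ.condKernel a := by
  have h : ρ = ρ.fst ⊗ₘ ρ.condKernel.map f := by
    rw [Measure.compProd_map hf, ρ.disintegrate, hρ.map_eq]
  filter_upwards [eq_condKernel_of_measure_eq_compProd _ h] with a ha
  rwa [Kernel.map_apply _ hf] at ha

lemma map_slice_ae_eq (hρν : ρ.fst ≪ ν) {f : Ω → Ω} (hf : Measurable f)
    (hρ : MeasurePreserving (Prod.map id f) ρ ρ) :
    ∀ᵐ a ∂ν, (slice ρ ν a).map f = slice ρ ν a := by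
  have := Measure.haveLebesgueDecomposition_of_sigmaFinite ρ.fst ν
  have h := condKernel_map_ae_eq hf hρ
  rw [← Measure.withDensity_rnDeriv_eq _ _ hρν,
    ae_withDensity_iff (Measure.measurable_rnDeriv _ _)] at h
  filter_upwards [h] with a ha
  rw [slice_apply]
  rcases eq_or_ne (ρ.fst.rnDeriv ν a) 0 with h0 | h0
  · simp [h0]
  · rw [Measure.map_smul, ha h0]

end Slice

section SignedSlice

variable {X α Ω : Type*} [MeasurableSpace X] [MeasurableSpace α] [MeasurableSpace Ω]

lemma totalVariation_withDensityᵥ_univ_le (m : Measure X) (w : X → ℝ) :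
    SignedMeasure.totalVariation (m.withDensityᵥ w) univ ≤ ∫⁻ x, ‖w x‖ₑ ∂m := by
  by_cases h : Integrable w m
  · rw [SignedMeasure.totalVariation_eq_variation, Measure.variation_withDensityᵥ h]
    simp
  · simp [Measure.withDensityᵥ, h, SignedMeasure.totalVariation_zero]

lemma measurable_withDensityᵥ_apply {κ : Kernel α Ω} [IsSFiniteKernel κ] {v : α × Ω → ℝ}
    (hv : Measurable v) {B : Set Ω} (hB : MeasurableSet B) :
    Measurable fun a => (κ a).withDensityᵥ (fun x => v (a, x)) B := by
  classical
  have h_ite : (fun a => (κ a).withDensityᵥ (fun x => v (a, x)) B) = fun a =>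
      if Integrable (fun x => v (a, x)) (κ a) then ∫ x in B, v (a, x) ∂(κ a) else 0 := by
    funext a
    split_ifs with h
    · rw [withDensityᵥ_apply h hB]
    · simp [Measure.withDensityᵥ, h]
  rw [h_ite]
  refine Measurable.ite (measurableSet_kernel_integrable (f := fun a x => v (a, x))
    hv.stronglyMeasurable) ?_ measurable_const
  have := (hv.stronglyMeasurable.integral_kernel_prod_right (κ := κ.restrict hB)
    (f := fun a x => v (a, x))).measurable
  simpa only [Kernel.restrict_apply] using this

lemma ae_map_withDensityᵥ_eq {ν : Measure α} [SFinite ν] {κ : Kernel α Ω} [IsSFiniteKernel κ]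
    {f : Ω → Ω} (hf : Measurable f) (hκ : ∀ᵐ a ∂ν, (κ a).map f = κ a) {v : α × Ω → ℝ}
    (hv : Integrable v (ν ⊗ₘ κ)) (hvf : v ∘ Prod.map id f =ᵐ[ν ⊗ₘ κ] v) :
    ∀ᵐ a ∂ν, ((κ a).withDensityᵥ fun x => v (a, x)).map f =
      (κ a).withDensityᵥ fun x => v (a, x) := by
  filter_upwards [hκ, ((Measure.integrable_compProd_iff hv.aestronglyMeasurable).1 hv).1,
    Measure.ae_ae_of_ae_compProd hvf] with a ha hva hvfa
  have h_comp : (κ a).withDensityᵥ ((fun x => v (a, x)) ∘ f) =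
      (κ a).withDensityᵥ fun x => v (a, x) := WithDensityᵥEq.congr_ae hvfa
  rw [← h_comp, map_withDensityᵥ_comp hf (ha.symm ▸ hva), ha, h_comp]

lemma signedDisintegrates_withDensityᵥ {ρ : Measure (I × Circle)} {κ : Kernel I Circle}
    (hκ : Disintegrates ρ κ) {v : I × Circle → ℝ} (hv : Measurable v) (hvi : Integrable v ρ) :
    SignedDisintegrates (ρ.withDensityᵥ v) fun t => (κ t).withDensityᵥ fun x => v (t, x) := by
  obtain ⟨_, -, rfl⟩ := hκ
  refine ⟨fun B hB => measurable_withDensityᵥ_apply hv hB, ?_, fun A B hA hB => ?_⟩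
  · calc ∫⁻ t, SignedMeasure.totalVariation ((κ t).withDensityᵥ fun x => v (t, x)) univ
        ≤ ∫⁻ t, ∫⁻ x, ‖v (t, x)‖ₑ ∂(κ t) :=
          lintegral_mono fun t => totalVariation_withDensityᵥ_univ_le _ _
      _ = ∫⁻ p, ‖v p‖ₑ ∂(volume ⊗ₘ κ) := (Measure.lintegral_compProd hv.enorm).symm
      _ < ∞ := hvi.2
  · rw [withDensityᵥ_apply hvi (hA.prod hB), Measure.setIntegral_compProd hA hB hvi.integrableOn]
    refine integral_congr_ae (ae_restrict_of_ae ?_)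
    filter_upwards [((Measure.integrable_compProd_iff hvi.aestronglyMeasurable).1 hvi).1]
      with t ht
    rw [withDensityᵥ_apply ht hB]

end SignedSlice

section TestFunctions

lemma isOpenQuotientMap_circleExp : IsOpenQuotientMap Circle.exp :=
  ⟨Circle.exp_surjective, Circle.exp.continuous, isLocalHomeomorph_circleExp.isOpenMap⟩

variable {φ : ℝ × Circle → ℝ}

lemma continuous_of_angular (h : Continuous fun p : ℝ × ℝ => φ (p.1, Circle.exp p.2)) :
    Continuous φ :=
  (IsOpenQuotientMap.id.prodMap isOpenQuotientMap_circleExp).isQuotientMap.continuous_iff.2 h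

lemma IsC1.hasDerivAt_dt (hφ : IsC1 φ) (t θ : ℝ) :
    HasDerivAt (fun s => φ (s, Circle.exp θ))
      (fderiv ℝ (fun p : ℝ × ℝ => φ (p.1, Circle.exp p.2)) (t, θ) (1, 0)) t :=
  ((hφ.differentiable one_ne_zero (t, θ)).hasFDerivAt.comp_hasDerivAt t
    ((hasDerivAt_id t).prodMk (hasDerivAt_const t θ)) :)

lemma IsC1.hasDerivAt_dθ (hφ : IsC1 φ) (t θ : ℝ) :
    HasDerivAt (fun s => φ (t, Circle.exp θ * Circle.exp s))
      (fderiv ℝ (fun p : ℝ × ℝ => φ (p.1, Circle.exp p.2)) (t, θ) (0, 1)) 0 := by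
  have h_line : HasDerivAt (fun s : ℝ => (t, θ + s)) ((0 : ℝ), (1 : ℝ)) 0 :=
    (hasDerivAt_const _ t).prodMk ((hasDerivAt_id (0 : ℝ)).const_add θ)
  have h_comp := (hφ.differentiable one_ne_zero (t, θ + 0)).hasFDerivAt.comp_hasDerivAt 0 h_line
  simpa [Function.comp_def, Circle.exp_add] using h_comp

lemma IsC1.continuous (hφ : IsC1 φ) : Continuous φ :=
  continuous_of_angular (ContDiff.continuous hφ)

lemma IsC1.continuous_dt (hφ : IsC1 φ) : Continuous (dt φ) :=
  continuous_of_angular <| ((hφ.continuous_fderiv one_ne_zero).clm_apply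
    (continuous_const (y := ((1 : ℝ), (0 : ℝ))))).congr
      fun p => (hφ.hasDerivAt_dt p.1 p.2).deriv.symm

lemma IsC1.continuous_dθ (hφ : IsC1 φ) : Continuous (dθ φ) :=
  continuous_of_angular <| ((hφ.continuous_fderiv one_ne_zero).clm_apply
    (continuous_const (y := ((0 : ℝ), (1 : ℝ))))).congr
      fun p => (hφ.hasDerivAt_dθ p.1 p.2).deriv.symm

lemma IsC1.contDiff_time (hφ : IsC1 φ) (x : Circle) : ContDiff ℝ 1 fun t => φ (t, x) := by
  obtain ⟨θ, rfl⟩ := Circle.exp_surjective x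
  exact ContDiff.comp (g := fun p : ℝ × ℝ => φ (p.1, Circle.exp p.2)) hφ
    (contDiff_id.prodMk contDiff_const)

lemma isC1_of_time {u : ℝ → ℝ} (hu : ContDiff ℝ 1 u) : IsC1 fun p => u p.1 :=
  hu.comp contDiff_fst

lemma isC1_comp_antipode (hφ : IsC1 φ) : IsC1 fun p => φ (p.1, antipode p.2) := by
  have neg_exp : ∀ θ, -Circle.exp θ = Circle.exp (θ + Real.pi) := fun θ => by
    ext; simp [Circle.exp_add]
  have h_shift : ContDiff ℝ 1 fun p : ℝ × ℝ => (p.1, p.2 + Real.pi) := by fun_prop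
  simpa [IsC1, Function.comp_def, antipode, neg_exp] using ContDiff.comp hφ h_shift

/-- The triples `(a, b, c)` of continuous functions that are paired with the components of a
`Path`. -/
abbrev Test : Type := C(I × Circle, ℝ) × C(I × Circle, ℝ) × C(I × Circle, ℝ)

/-- The triple `(∂_t φ, ∂_θ φ, φ)` against which the continuity equation tests a `Path`. -/
def IsC1.test (hφ : IsC1 φ) : Test :=
  (⟨fun p => dt φ (p.1, p.2), hφ.continuous_dt.comp (by fun_prop)⟩,
    ⟨fun p => dθ φ (p.1, p.2), hφ.continuous_dθ.comp (by fun_prop)⟩,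
    ⟨fun p => φ (p.1, p.2), hφ.continuous.comp (by fun_prop)⟩)

/-- The map `(t, x) ↦ (t, -x)` of `[0,1] × 𝕊¹`. -/
def flip : C(I × Circle, I × Circle) :=
  ⟨Prod.map id antipode, by unfold antipode; fun_prop⟩

lemma flip_flip (p : I × Circle) : flip (flip p) = p := Prod.ext rfl (neg_neg p.2)

/-- The action of the antipodal map on test triples. -/
def flipTest : Test →ₗ[ℝ] Test :=
  let pullback : C(I × Circle, ℝ) →ₗ[ℝ] C(I × Circle, ℝ) :=
    (ContinuousMap.compRightAlgHom ℝ ℝ flip).toLinearMap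
  pullback.prodMap (pullback.prodMap pullback)

lemma flipTest_apply (a b c : C(I × Circle, ℝ)) :
    flipTest (a, b, c) = (a.comp flip, b.comp flip, c.comp flip) := rfl

lemma flipTest_flipTest (p : Test) : flipTest (flipTest p) = p := by
  have h : ∀ f : C(I × Circle, ℝ), (f.comp flip).comp flip = f := fun f =>
    ContinuousMap.ext fun x => congrArg f (flip_flip x)
  exact Prod.ext (h _) (Prod.ext (h _) (h _))

lemma flipTest_test (hφ : IsC1 φ) : flipTest hφ.test = (isC1_comp_antipode hφ).test := by
  refine Prod.ext rfl (Prod.ext (ContinuousMap.ext fun p => ?_) rfl)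
  simp [flipTest_apply, IsC1.test, flip, dθ, antipode, neg_mul]

end TestFunctions

section Admissible

/-- The set of test triples `(a, b, c)` with `a + (b² + c² / δ²) / 2 ≤ 0`. By convex duality,
`f_δ(r, w, z)` is the supremum of `a r + b w + c z` over real triples with this property. -/
def paraboloid (δ : ℝ) : Set Test :=
  {p | ∀ x, p.1 x + (p.2.1 x ^ 2 + p.2.2 x ^ 2 / δ ^ 2) / 2 ≤ 0}

/-- A linear functional on test triples that behaves like the pairing with a solution of the
continuity equation of energy at most `E`, the energy being expressed by duality. -/
structure IsAdmissible (δ E : ℝ) (ρ₀ ρ₁ : Measure Circle) (L : Test →ₗ[ℝ] ℝ) : Prop where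
  continuity {φ : ℝ × Circle → ℝ} (hφ : IsC1 φ) :
    L hφ.test = (∫ x, φ (1, x) ∂ρ₁) - ∫ x, φ (0, x) ∂ρ₀
  le_of_mem {p : Test} (hp : p ∈ paraboloid δ) : L p ≤ E

namespace IsAdmissible

variable {δ E : ℝ} {ρ₀ ρ₁ : Measure Circle} {L L' : Test →ₗ[ℝ] ℝ}

lemma energy_nonneg (h : IsAdmissible δ E ρ₀ ρ₁ L) : 0 ≤ E := by
  simpa using h.le_of_mem (p := 0) fun x => by simp

lemma nonneg (h : IsAdmissible δ E ρ₀ ρ₁ L) {a : C(I × Circle, ℝ)} (ha : 0 ≤ a) :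
    0 ≤ L (a, 0, 0) := by
  by_contra! hneg
  have hs : ∀ s : ℝ, 0 ≤ s → s * -L (a, 0, 0) ≤ E := fun s hs => by
    have := h.le_of_mem (p := -s • (a, 0, 0)) fun x => by
      simpa using mul_nonneg hs (ha x)
    rwa [map_smul, smul_eq_mul, neg_mul_comm] at this
  have := hs ((E + 1) / -L (a, 0, 0))
    (div_nonneg (by linarith [h.energy_nonneg]) (by linarith))
  rw [div_mul_cancel₀ _ (by linarith)] at this
  linarith

lemma le_add (h : IsAdmissible δ E ρ₀ ρ₁ L) {a b c k : C(I × Circle, ℝ)}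
    (hk : ∀ x, a x + (b x ^ 2 + c x ^ 2 / δ ^ 2) / 2 ≤ k x) :
    L (a, b, c) ≤ E + L (k, 0, 0) := by
  have := h.le_of_mem (p := (a, b, c) - (k, 0, 0)) fun x => by
    have := hk x
    simp only [Prod.mk_sub_mk, sub_zero, ContinuousMap.sub_apply]
    linarith
  rw [map_sub] at this
  linarith

lemma mass_le (h : IsAdmissible δ E ρ₀ ρ₁ L) (hδ : δ ≠ 0) :
    L (1, 0, 0) ≤ 2 * (ρ₁.real univ + E / δ ^ 2) := by
  let T : C(I × Circle, ℝ) := ⟨fun p => p.1, by fun_prop⟩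
  have h_time : L (1, 0, 0) + L (0, 0, T) = ρ₁.real univ := by
    have h_test : (1, 0, 0) + (0, 0, T) = (isC1_of_time contDiff_id).test := by
      refine Prod.ext ?_ (Prod.ext ?_ ?_) <;> ext p <;> simp [IsC1.test, dt, dθ, T]
    rw [← map_add, h_test, h.continuity]
    simp
  have h_young : L (0, 0, (-δ ^ 2) • T) ≤ E + L ((δ ^ 2 / 2) • 1, 0, 0) := h.le_add fun p => by
    have hT : T p ^ 2 ≤ 1 := pow_le_one₀ p.1.2.1 p.1.2.2
    simp only [ContinuousMap.zero_apply, ContinuousMap.smul_apply, ContinuousMap.one_apply,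
      smul_eq_mul, mul_pow, neg_sq]
    field_simp
    nlinarith [sq_nonneg δ]
  have e₁ : ((0, 0, (-δ ^ 2) • T) : Test) = (-δ ^ 2) • (0, 0, T) := by simp
  have e₂ : (((δ ^ 2 / 2) • 1, 0, 0) : Test) = (δ ^ 2 / 2) • (1, 0, 0) := by simp
  rw [e₁, e₂, map_smul, map_smul, smul_eq_mul, smul_eq_mul] at h_young
  have : -L (0, 0, T) - L (1, 0, 0) / 2 ≤ E / δ ^ 2 := by
    rw [le_div_iff₀ (by positivity)]
    linarith
  linarith

lemma abs_apply_le (h : IsAdmissible δ E ρ₀ ρ₁ L) (hδ : δ ≠ 0) (a b c : C(I × Circle, ℝ)) :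
    |L (a, b, c)| ≤ E + (‖a‖ + (‖b‖ ^ 2 + ‖c‖ ^ 2 / δ ^ 2) / 2) *
      (2 * (ρ₁.real univ + E / δ ^ 2)) := by
  have h_le : ∀ a b c : C(I × Circle, ℝ), L (a, b, c) ≤
      E + (‖a‖ + (‖b‖ ^ 2 + ‖c‖ ^ 2 / δ ^ 2) / 2) * (2 * (ρ₁.real univ + E / δ ^ 2)) := by
    intro a b c
    set k := ‖a‖ + (‖b‖ ^ 2 + ‖c‖ ^ 2 / δ ^ 2) / 2
    have sq_le : ∀ (f : C(I × Circle, ℝ)) x, f x ^ 2 ≤ ‖f‖ ^ 2 := fun f x => by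
      simpa using pow_le_pow_left₀ (norm_nonneg (f x)) (f.norm_coe_le_norm x) 2
    calc L (a, b, c) ≤ E + L (k • 1, 0, 0) := h.le_add fun x => by
          simp only [ContinuousMap.smul_apply, ContinuousMap.one_apply, smul_eq_mul, mul_one, k]
          gcongr ?_ + (?_ + ?_ / _) / 2
          exacts [(le_abs_self _).trans (a.norm_coe_le_norm x), sq_le b x, sq_le c x]
      _ = E + k * L (1, 0, 0) := by
          rw [← smul_eq_mul, ← map_smul]
          simp
      _ ≤ _ := by
          gcongr
          exact h.mass_le hδ
  refine abs_le.2 ⟨?_, h_le a b c⟩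
  have := h_le (-a) (-b) (-c)
  rw [← Prod.neg_mk, ← Prod.neg_mk, map_neg, norm_neg, norm_neg, norm_neg] at this
  linarith

lemma mono_energy {E' : ℝ} (h : IsAdmissible δ E ρ₀ ρ₁ L) (hE : E ≤ E') :
    IsAdmissible δ E' ρ₀ ρ₁ L :=
  ⟨h.continuity, fun hp => (h.le_of_mem hp).trans hE⟩

lemma half_add (h : IsAdmissible δ E ρ₀ ρ₁ L) (h' : IsAdmissible δ E ρ₀ ρ₁ L') :
    IsAdmissible δ E ρ₀ ρ₁ ((1 / 2 : ℝ) • (L + L')) where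
  continuity hφ := by
    simp only [LinearMap.smul_apply, LinearMap.add_apply, smul_eq_mul, h.continuity hφ,
      h'.continuity hφ]
    ring
  le_of_mem hp := by
    simp only [LinearMap.smul_apply, LinearMap.add_apply, smul_eq_mul]
    linarith [h.le_of_mem hp, h'.le_of_mem hp]

lemma comp_flipTest (h : IsAdmissible δ E ρ₀ ρ₁ L) (h₀ : ρ₀.map antipode = ρ₀)
    (h₁ : ρ₁.map antipode = ρ₁) : IsAdmissible δ E ρ₀ ρ₁ (L ∘ₗ flipTest) where
  continuity {φ} hφ := by
    have h_inv : ∀ (t : ℝ) {ρ : Measure Circle}, ρ.map antipode = ρ →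
        ∫ x, φ (t, antipode x) ∂ρ = ∫ x, φ (t, x) ∂ρ := fun t ρ hρ => by
      conv_rhs => rw [← hρ]
      exact (integral_map measurable_antipode.aemeasurable
        (hφ.continuous.comp (by fun_prop : Continuous fun x => (t, x))).aestronglyMeasurable).symm
    rw [LinearMap.comp_apply, flipTest_test, h.continuity, h_inv 1 h₁, h_inv 0 h₀]
  le_of_mem hp := h.le_of_mem fun x => hp (flip x)

lemma exists_symmetric (h : IsAdmissible δ E ρ₀ ρ₁ L) (h₀ : ρ₀.map antipode = ρ₀)
    (h₁ : ρ₁.map antipode = ρ₁) :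
    ∃ L', IsAdmissible δ E ρ₀ ρ₁ L' ∧ ∀ p, L' (flipTest p) = L' p :=
  ⟨_, h.half_add (h.comp_flipTest h₀ h₁), fun p => by simp [flipTest_flipTest, add_comm]⟩

end IsAdmissible

lemma exists_isAdmissible_of_tendsto {δ E : ℝ} (hδ : δ ≠ 0) {ρ₀ ρ₁ : Measure Circle} {e : ℕ → ℝ}
    (he : Filter.Tendsto e Filter.atTop (nhds E)) (h : ∀ n, ∃ L, IsAdmissible δ (e n) ρ₀ ρ₁ L) :
    ∃ L, IsAdmissible δ E ρ₀ ρ₁ L := by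
  choose L hL using h
  obtain ⟨B, hB⟩ := he.bddAbove_range
  have hLB : ∀ n, IsAdmissible δ B ρ₀ ρ₁ (L n) := fun n => (hL n).mono_energy (hB ⟨n, rfl⟩)
  obtain ⟨Λ, hΛ⟩ := exists_linearMap_tendsto_of_bounded (Filter.hyperfilter ℕ) L
    fun p => ⟨_, fun n => (hLB n).abs_apply_le hδ p.1 p.2.1 p.2.2⟩
  refine ⟨Λ, fun {φ} hφ => ?_, fun {p} hp => ?_⟩
  · refine tendsto_nhds_unique (hΛ hφ.test) ?_
    simp only [(hL _).continuity hφ, tendsto_const_nhds]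
  · exact le_of_tendsto_of_tendsto' (hΛ p) (he.mono_left Nat.hyperfilter_le_atTop)
      fun n => (hL n).le_of_mem hp

lemma exists_isLeast_isAdmissible {δ : ℝ} (hδ : δ ≠ 0) {ρ₀ ρ₁ : Measure Circle}
    (h : ∃ E L, IsAdmissible δ E ρ₀ ρ₁ L) :
    ∃ E, IsLeast {E | ∃ L, IsAdmissible δ E ρ₀ ρ₁ L} E := by
  have bdd : BddBelow {E | ∃ L, IsAdmissible δ E ρ₀ ρ₁ L} :=
    ⟨0, fun E ⟨L, hL⟩ => hL.energy_nonneg⟩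
  obtain ⟨e, -, he, he_mem⟩ := exists_seq_tendsto_sInf h bdd
  exact ⟨_, exists_isAdmissible_of_tendsto hδ he he_mem, fun E hE => csInf_le bdd hE⟩

end Admissible

section DensityFunctional

lemma mul_add_mul_add_mul_le_cost {δ r w z a b c : ℝ} (hδ : δ ≠ 0) (hfin : cost δ r w z < ∞)
    (hp : a + (b ^ 2 + c ^ 2 / δ ^ 2) / 2 ≤ 0) :
    a * r + b * w + c * z ≤ (cost δ r w z).toReal := by
  unfold cost at *
  split_ifs at * with hr h0
  · rw [ENNReal.toReal_ofReal (by positivity), ← sub_nonneg]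
    have complete_square : (w ^ 2 + δ ^ 2 * z ^ 2) / (2 * r) - (a * r + b * w + c * z) =
        ((w - r * b) ^ 2 + (δ * z - r * c / δ) ^ 2) / (2 * r) +
          -(a + (b ^ 2 + c ^ 2 / δ ^ 2) / 2) * r := by
      field_simp
      ring
    rw [complete_square]
    have := mul_nonneg (neg_nonneg.2 hp) hr.le
    positivity
  · simp [h0]
  · simp at hfin

variable {ν : Measure (I × Circle)} {r w z : I × Circle → ℝ}

/-- The pairing of test triples with the triple of measures of densities `r`, `w`, `z` with respect
to `ν`. -/
def densityFunctional (hr : Integrable r ν) (hw : Integrable w ν) (hz : Integrable z ν) :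
    Test →ₗ[ℝ] ℝ where
  toFun p := ∫ x, p.1 x * r x ∂ν + ∫ x, p.2.1 x * w x ∂ν + ∫ x, p.2.2 x * z x ∂ν
  map_add' p q := by
    simp only [Prod.fst_add, Prod.snd_add, ContinuousMap.add_apply, add_mul]
    rw [integral_add (integrable_continuousMap_mul _ hr) (integrable_continuousMap_mul _ hr),
      integral_add (integrable_continuousMap_mul _ hw) (integrable_continuousMap_mul _ hw),
      integral_add (integrable_continuousMap_mul _ hz) (integrable_continuousMap_mul _ hz)]
    ring
  map_smul' s p := by
    simp [mul_assoc, integral_const_mul, mul_add]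

lemma densityFunctional_apply {hr : Integrable r ν} {hw : Integrable w ν} {hz : Integrable z ν}
    (p : Test) : densityFunctional hr hw hz p =
      ∫ x, p.1 x * r x ∂ν + ∫ x, p.2.1 x * w x ∂ν + ∫ x, p.2.2 x * z x ∂ν := rfl

lemma densityFunctional_le_of_mem {δ : ℝ} (hδ : δ ≠ 0) (hr : Integrable r ν)
    (hw : Integrable w ν) (hz : Integrable z ν) (hfin : ∫⁻ x, cost δ (r x) (w x) (z x) ∂ν ≠ ∞)
    {p : Test} (hp : p ∈ paraboloid δ) :
    densityFunctional hr hw hz p ≤ (∫⁻ x, cost δ (r x) (w x) (z x) ∂ν).toReal := by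
  have hmeas : AEMeasurable (fun x => cost δ (r x) (w x) (z x)) ν :=
    (measurable_cost δ).comp_aemeasurable
      (hr.aemeasurable.prodMk (hw.aemeasurable.prodMk hz.aemeasurable))
  have hlt := ae_lt_top' hmeas hfin
  have hir := integrable_continuousMap_mul p.1 hr
  have hiw := integrable_continuousMap_mul p.2.1 hw
  have hiz := integrable_continuousMap_mul p.2.2 hz
  rw [densityFunctional_apply, ← integral_add hir hiw, ← integral_add (by exact hir.add hiw) hiz,
    ← integral_toReal hmeas hlt]
  refine integral_mono_ae ((hir.add hiw).add hiz)
    (integrable_toReal_of_lintegral_ne_top hmeas hfin) ?_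
  filter_upwards [hlt] with x hx
  exact mul_add_mul_add_mul_le_cost hδ hx (hp x)

end DensityFunctional

section ContinuityEquation

lemma ρ_le_ref (μ : Path) : (μ.ρ : Measure (I × Circle)) ≤ μ.ref :=
  (Measure.le_add_right le_rfl).trans (Measure.le_add_right le_rfl)

lemma totalVariation_ω_le_ref (μ : Path) : μ.ω.totalVariation ≤ μ.ref :=
  (Measure.le_add_left le_rfl).trans (Measure.le_add_right le_rfl)

lemma totalVariation_ζ_le_ref (μ : Path) : μ.ζ.totalVariation ≤ μ.ref :=
  Measure.le_add_left le_rfl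

variable {δ : ℝ} {ρ₀ ρ₁ : Measure Circle} {μ : Path}

lemma exists_isAdmissible_of_mem_CE (hδ : δ ≠ 0) (hμ : μ ∈ CE ρ₀ ρ₁) (hfin : energy δ μ ≠ ∞) :
    ∃ L, IsAdmissible δ (energy δ μ).toReal ρ₀ ρ₁ L := by
  have hρ := (ρ_le_ref μ).absolutelyContinuous
  have hω := (totalVariation_ω_le_ref μ).absolutelyContinuous
  have hζ := (totalVariation_ζ_le_ref μ).absolutelyContinuous
  refine ⟨densityFunctional Measure.integrable_toReal_rnDeriv
    (SignedMeasure.integrable_rnDeriv μ.ω μ.ref) (SignedMeasure.integrable_rnDeriv μ.ζ μ.ref),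
    fun {φ} hφ => ?_, fun hp => densityFunctional_le_of_mem hδ _ _ _ hfin hp⟩
  rw [← hμ φ hφ, densityFunctional_apply]
  have := Measure.haveLebesgueDecomposition_of_sigmaFinite (μ.ρ : Measure (I × Circle)) μ.ref
  congr 1
  · congr 1
    · rw [← integral_rnDeriv_smul hρ]
      exact integral_congr_ae (.of_forall fun _ => mul_comm _ _)
    · exact (integral_eq_integral_mul_rnDeriv hω hφ.test.2.1.measurable
        hφ.test.2.1.norm_coe_le_norm).symm
  · exact (integral_eq_integral_mul_rnDeriv hζ hφ.test.2.2.measurable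
      hφ.test.2.2.norm_coe_le_norm).symm

end ContinuityEquation

section Growth

lemma integral_unitInterval (f : ℝ → ℝ) : ∫ t : I, f t = ∫ t in (0 : ℝ)..1, f t := by
  rw [intervalIntegral.integral_of_le zero_le_one, ← integral_Icc_eq_integral_Ioc]
  exact integral_subtype measurableSet_Icc f

lemma integral_deriv_mul_add_mul_deriv {u s : ℝ → ℝ} (hu : ContDiff ℝ 1 u) (hs : ContDiff ℝ 1 s) :
    ∫ t : I, (deriv u t * s t + u t * deriv s t) = u 1 * s 1 - u 0 * s 0 := by
  have hu' := hu.continuous_deriv le_rfl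
  have hs' := hs.continuous_deriv le_rfl
  rw [integral_unitInterval fun t => deriv u t * s t + u t * deriv s t]
  exact intervalIntegral.integral_deriv_mul_eq_sub
    (fun t _ => (hu.differentiable one_ne_zero t).hasDerivAt)
    (fun t _ => (hs.differentiable one_ne_zero t).hasDerivAt)
    (hu'.intervalIntegrable _ _) (hs'.intervalIntegrable _ _)

lemma integral_prod_dt_mul_add {φ : ℝ × Circle → ℝ} (hφ : IsC1 φ) (m : Measure Circle)
    [IsFiniteMeasure m] {s : ℝ → ℝ} (hs : ContDiff ℝ 1 s) :
    ∫ p : I × Circle, dt φ (p.1, p.2) * s p.1 ∂(volume.prod m) +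
      ∫ p : I × Circle, φ (p.1, p.2) * deriv s p.1 ∂(volume.prod m) =
    (∫ x, φ (1, x) ∂m) * s 1 - (∫ x, φ (0, x) ∂m) * s 0 := by
  have hsc := hs.continuous
  have _hsc' := hs.continuous_deriv le_rfl
  have hφc := hφ.continuous
  have hφc' := hφ.continuous_dt
  have int_dt : Integrable (fun p : I × Circle => dt φ (p.1, p.2) * s p.1) (volume.prod m) :=
    integrable_of_continuous (by fun_prop) _
  have int_φ : Integrable (fun p : I × Circle => φ (p.1, p.2) * deriv s p.1) (volume.prod m) :=
    integrable_of_continuous (by fun_prop) _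
  have int_slice : ∀ t : ℝ, Integrable (fun x => φ (t, x)) m := fun t =>
    integrable_of_continuous (by fun_prop) m
  rw [← integral_add int_dt int_φ, integral_prod_symm _ (by exact int_dt.add int_φ),
    ← integral_mul_const, ← integral_mul_const,
    ← integral_sub ((int_slice 1).mul_const _) ((int_slice 0).mul_const _)]
  exact integral_congr_ae
    (.of_forall fun x => integral_deriv_mul_add_mul_deriv (hφ.contDiff_time x) hs)

lemma cost_sq_le (δ s s' : ℝ) :
    cost δ (s ^ 2) 0 (2 * s * s') ≤ ENNReal.ofReal (2 * δ ^ 2 * s' ^ 2) := by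
  unfold cost
  rcases eq_or_ne s 0 with rfl | hs
  · simp
  · rw [if_pos (by positivity)]
    refine ENNReal.ofReal_le_ofReal (le_of_eq ?_)
    field_simp
    ring

/-- The functional of the triple `ρ = dt ⊗ s(t)² m`, `ω = 0`, `ζ = ∂_t ρ`. -/
lemma exists_growthFunctional {δ : ℝ} (hδ : δ ≠ 0) (m : Measure Circle) [IsFiniteMeasure m]
    {s : ℝ → ℝ} (hs : ContDiff ℝ 1 s) :
    ∃ E, ∃ L : Test →ₗ[ℝ] ℝ, (∀ p ∈ paraboloid δ, L p ≤ E) ∧ ∀ {φ} (hφ : IsC1 φ),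
      L hφ.test = (∫ x, φ (1, x) ∂m) * s 1 ^ 2 - (∫ x, φ (0, x) ∂m) * s 0 ^ 2 := by
  have hsc := hs.continuous
  have _hsc' := hs.continuous_deriv le_rfl
  have hr : Integrable (fun p : I × Circle => s p.1 ^ 2) (volume.prod m) :=
    integrable_of_continuous (by fun_prop) _
  have h0 : Integrable (fun _ : I × Circle => (0 : ℝ)) (volume.prod m) := integrable_zero _ _ _
  have hz : Integrable (fun p : I × Circle => 2 * s p.1 * deriv s p.1) (volume.prod m) :=
    integrable_of_continuous (by fun_prop) _
  have hE : Integrable (fun p : I × Circle => 2 * δ ^ 2 * deriv s p.1 ^ 2) (volume.prod m) :=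
    integrable_of_continuous (by fun_prop) _
  have cost_ne_top :
      ∫⁻ p : I × Circle, cost δ (s p.1 ^ 2) 0 (2 * s p.1 * deriv s p.1) ∂(volume.prod m) ≠ ∞ :=
    ne_top_of_le_ne_top hE.lintegral_lt_top.ne (lintegral_mono fun p => cost_sq_le δ _ _)
  refine ⟨_, densityFunctional hr h0 hz,
    fun p hp => densityFunctional_le_of_mem hδ hr h0 hz cost_ne_top hp, fun {φ} hφ => ?_⟩
  have deriv_sq : deriv (fun t => s t ^ 2) = fun t => 2 * s t * deriv s t := funext fun t => by
    simp [deriv_fun_pow (hs.differentiable one_ne_zero t)]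
  have := integral_prod_dt_mul_add hφ m (hs.pow 2)
  rw [deriv_sq] at this
  simp only [densityFunctional_apply, mul_zero, integral_zero, add_zero]
  exact this

lemma exists_isAdmissible {δ : ℝ} (hδ : δ ≠ 0) (ρ₀ ρ₁ : Measure Circle) [IsFiniteMeasure ρ₀]
    [IsFiniteMeasure ρ₁] : ∃ E L, IsAdmissible δ E ρ₀ ρ₁ L := by
  obtain ⟨E₀, L₀, hE₀, hL₀⟩ := exists_growthFunctional hδ ρ₀ (contDiff_const.sub contDiff_id :
    ContDiff ℝ 1 fun t : ℝ => 1 - t)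
  obtain ⟨E₁, L₁, hE₁, hL₁⟩ := exists_growthFunctional hδ ρ₁ contDiff_id
  refine ⟨E₀ + E₁, L₀ + L₁, fun {φ} hφ => ?_, fun hp => add_le_add (hE₀ _ hp) (hE₁ _ hp)⟩
  rw [LinearMap.add_apply, hL₀, hL₁]
  simp
  ring

end Growth

section TimeMarginal

lemma exists_monotone_primitive (f : C(I, ℝ)) (hf : 0 ≤ f) :
    ∃ u : ℝ → ℝ, ContDiff ℝ 1 u ∧ Monotone u ∧ u 0 = 0 ∧ u 1 = ∫ t, f t ∧
      ∀ t : I, deriv u t = f t := by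
  let F : ℝ → ℝ := IccExtend zero_le_one f
  have F_cont : Continuous F := f.continuous.Icc_extend'
  have F_coe (t : I) : F t = f t := IccExtend_val _ _ t
  let u (t : ℝ) : ℝ := ∫ s in (0 : ℝ)..t, F s
  have u_deriv (t : ℝ) : HasDerivAt u (F t) t := F_cont.integral_hasStrictDerivAt 0 t |>.hasDerivAt
  have deriv_u : deriv u = F := funext fun t => (u_deriv t).deriv
  refine ⟨u, contDiff_one_iff_deriv.2 ⟨fun t => (u_deriv t).differentiableAt, deriv_u ▸ F_cont⟩,
    monotone_of_hasDerivAt_nonneg u_deriv fun t => hf _, intervalIntegral.integral_same, ?_,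
    fun t => deriv_u ▸ F_coe t⟩
  simp only [u, ← integral_unitInterval F, F_coe]

lemma integral_deriv_add_integral_mul_rnDeriv {ρ₀ ρ₁ : Measure Circle} {μ : Path}
    (hμ : μ ∈ CE ρ₀ ρ₁) {u : ℝ → ℝ} (hu : ContDiff ℝ 1 u) :
    ∫ p, deriv u p.1 ∂(μ.ρ : Measure (I × Circle)) + ∫ p, u p.1 * μ.ζ.rnDeriv μ.ref p ∂μ.ref =
      u 1 * ρ₁.real univ - u 0 * ρ₀.real univ := by
  let U : C(I × Circle, ℝ) := (isC1_of_time hu).test.2.2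
  have balance := hμ _ (isC1_of_time hu)
  rw [integral_eq_integral_mul_rnDeriv (f := fun p => u (p.1, p.2).1)
    (totalVariation_ζ_le_ref μ).absolutelyContinuous U.measurable U.norm_coe_le_norm] at balance
  simpa [dt, dθ, mul_comm] using balance

lemma fst_absolutelyContinuous {ρ₀ ρ₁ : Measure Circle} {μ : Path} (hμ : μ ∈ CE ρ₀ ρ₁) :
    (μ.ρ : Measure (I × Circle)).fst ≪ volume := by
  let g := μ.ζ.rnDeriv μ.ref
  have hg : Integrable g μ.ref := SignedMeasure.integrable_rnDeriv _ _
  let C := ρ₁.real univ + ∫ p, |g p| ∂μ.ref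
  have hC : 0 ≤ C := add_nonneg measureReal_nonneg (integral_nonneg fun p => abs_nonneg _)
  suffices h : (μ.ρ : Measure (I × Circle)).fst ≤ C.toNNReal • volume from
    h.absolutelyContinuous.trans Measure.smul_absolutelyContinuous
  refine le_of_forall_integral_le fun f hf => ?_
  obtain ⟨u, u_contDiff, u_mono, u_zero, u_one, deriv_u⟩ := exists_monotone_primitive f hf
  have source_bound : -∫ p, u p.1 * g p ∂μ.ref ≤ u 1 * ∫ p, |g p| ∂μ.ref := by
    rw [← integral_neg, ← integral_const_mul]
    refine integral_mono (integrable_continuousMap_mul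
      (isC1_of_time u_contDiff).test.2.2 hg).neg (hg.abs.const_mul _) fun p => ?_
    have u_nonneg : 0 ≤ u p.1 := u_zero ▸ u_mono p.1.2.1
    calc -(u p.1 * g p) ≤ |u p.1 * g p| := neg_le_abs _
      _ = u p.1 * |g p| := by rw [abs_mul, abs_of_nonneg u_nonneg]
      _ ≤ u 1 * |g p| := by gcongr; exact u_mono p.1.2.2
  have balance := integral_deriv_add_integral_mul_rnDeriv hμ u_contDiff
  calc ∫ t, f t ∂(μ.ρ : Measure (I × Circle)).fst = ∫ p, f p.1 ∂(μ.ρ : Measure (I × Circle)) :=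
        integral_map measurable_fst.aemeasurable f.continuous.aestronglyMeasurable
    _ = u 1 * ρ₁.real univ - ∫ p, u p.1 * g p ∂μ.ref := by
        simp only [deriv_u, u_zero] at balance
        linarith
    _ ≤ u 1 * C := by linarith
    _ = ∫ t, f t ∂(C.toNNReal • volume) := by
        rw [integral_smul_nnreal_measure, u_one, mul_comm, NNReal.smul_def, Real.coe_toNNReal C hC,
          smul_eq_mul]

end TimeMarginal

lemma integral_circle_eq_zero {m : Measure Circle} (hm : m.map antipode = m) :
    ∫ x : Circle, (x : ℂ) ∂m = 0 := by
  refine self_eq_neg.1 ?_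
  calc ∫ x : Circle, (x : ℂ) ∂m = ∫ x : Circle, (x : ℂ) ∂m.map antipode := by rw [hm]
    _ = ∫ x, (antipode x : ℂ) ∂m := integral_map measurable_antipode.aemeasurable
        (by fun_prop : Continuous fun x : Circle => (x : ℂ)).aestronglyMeasurable
    _ = -∫ x : Circle, (x : ℂ) ∂m := by simp [antipode, integral_neg]

section Representation

/-- The triple of measures `(ρ, vρ, gρ)`, a `Path` given by its velocity `v` and its growth
rate `g`. -/
def densityPath (ρ : Measure (I × Circle)) [IsFiniteMeasure ρ] (v g : I × Circle → ℝ) : Path :=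
  ⟨⟨ρ, inferInstance⟩, ρ.withDensityᵥ v, ρ.withDensityᵥ g⟩

variable {δ E : ℝ} {ρ₀ ρ₁ : Measure Circle} {L : Test →ₗ[ℝ] ℝ}
  {ρ : Measure (I × Circle)} [IsFiniteMeasure ρ] {v g : I × Circle → ℝ}

lemma energy_densityPath (δ : ℝ) (hv : Integrable v ρ) (hg : Integrable g ρ) :
    energy δ (densityPath ρ v g) = ∫⁻ p, ENNReal.ofReal ((v p ^ 2 + δ ^ 2 * g p ^ 2) / 2) ∂ρ := by
  have absolutelyContinuous {w : I × Circle → ℝ} (hw : Integrable w ρ) :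
      SignedMeasure.totalVariation (ρ.withDensityᵥ w) ≪ ρ := by
    rw [SignedMeasure.totalVariation_eq_variation, Measure.variation_withDensityᵥ hw]
    exact withDensity_absolutelyContinuous _ _
  have rnDeriv {w : I × Circle → ℝ} (hw : Integrable w ρ) :
      w =ᵐ[ρ] SignedMeasure.rnDeriv (ρ.withDensityᵥ w) ρ :=
    SignedMeasure.eq_rnDeriv 0 _ hw VectorMeasure.MutuallySingular.zero_left (zero_add _).symm
  rw [← energyWrt_eq_energy δ (densityPath ρ v g) ρ Measure.AbsolutelyContinuous.rfl
    (absolutelyContinuous hv) (absolutelyContinuous hg)]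
  refine lintegral_congr_ae ?_
  filter_upwards [rnDeriv hv, rnDeriv hg, Measure.rnDeriv_self ρ] with p hvp hgp hρp
  simp [densityPath, cost, ← hvp, ← hgp, hρp]

lemma densityPath_mem_CE (hv : Integrable v ρ) (hg : Integrable g ρ)
    (h : ∀ {φ} (hφ : IsC1 φ), ∫ p, hφ.test.1 p ∂ρ + ∫ p, hφ.test.2.1 p * v p ∂ρ +
      ∫ p, hφ.test.2.2 p * g p ∂ρ = ∫ x, φ (1, x) ∂ρ₁ - ∫ x, φ (0, x) ∂ρ₀) :
    densityPath ρ v g ∈ CE ρ₀ ρ₁ := fun φ hφ => by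
  rw [← h hφ, ← integral_withDensityᵥ hv hφ.test.2.1.measurable hφ.test.2.1.norm_coe_le_norm,
    ← integral_withDensityᵥ hg hφ.test.2.2.measurable hφ.test.2.2.norm_coe_le_norm]
  rfl

lemma IsAdmissible.exists_densities (hδ : δ ≠ 0) (h : IsAdmissible δ E ρ₀ ρ₁ L) :
    ∃ ρ : Measure (I × Circle), IsFiniteMeasure ρ ∧ ∃ v g : Lp ℝ 2 ρ,
      (∀ a b c, L (a, b, c) = ∫ p, a p ∂ρ + ∫ p, b p * v p ∂ρ + ∫ p, c p * g p ∂ρ) ∧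
      ∫ p, (v p ^ 2 + δ ^ 2 * g p ^ 2) / 2 ∂ρ ≤ E := by
  obtain ⟨ρ, _, hρ⟩ := exists_measure_integral_eq (L ∘ₗ LinearMap.inl ℝ _ _) fun a ha => h.nonneg ha
  obtain ⟨v, g, hN, hE⟩ := WFR.exists_densities (ρ := ρ) (E := E) hδ (L ∘ₗ LinearMap.inr ℝ _ _)
    fun b c => by
      let k : C(I × Circle, ℝ) := ⟨fun p => (b p ^ 2 + c p ^ 2 / δ ^ 2) / 2, by fun_prop⟩
      exact (h.le_add (a := 0) (k := k) fun p => (zero_add _).le).trans_eq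
        (congrArg (E + ·) (hρ k))
  refine ⟨ρ, ‹_›, v, g, fun a b c => ?_, hE⟩
  have split : ((a, b, c) : Test) = LinearMap.inl ℝ _ _ a + LinearMap.inr ℝ _ _ (b, c) := by simp
  rw [split, map_add, add_assoc]
  exact congrArg₂ (· + ·) (hρ a) (hN b c)

lemma measurePreserving_flip (h : ∀ a : C(I × Circle, ℝ), ∫ p, a (flip p) ∂ρ = ∫ p, a p ∂ρ) :
    MeasurePreserving flip ρ ρ := by
  refine ⟨flip.measurable, ext_of_forall_integral_eq_of_IsFiniteMeasure fun a => ?_⟩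
  rw [integral_map flip.measurable.aemeasurable a.continuous.aestronglyMeasurable]
  exact h a

lemma comp_flip_ae_eq (hρ : MeasurePreserving flip ρ ρ) (hv : MemLp v 2 ρ)
    (h : ∀ b : C(I × Circle, ℝ), ∫ p, b (flip p) * v p ∂ρ = ∫ p, b p * v p ∂ρ) :
    v ∘ flip =ᵐ[ρ] v := by
  refine ae_eq_of_forall_integral_mul_eq (hv.comp_measurePreserving hρ) hv fun b => ?_
  have hbv : AEStronglyMeasurable (fun p => b (flip p) * v p) (ρ.map flip) := by
    rw [hρ.map_eq]
    exact (b.comp flip).continuous.aestronglyMeasurable.mul hv.1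
  calc ∫ p, b p * (v ∘ flip) p ∂ρ = ∫ p, b (flip (flip p)) * v (flip p) ∂ρ := by
        simp only [flip_flip, Function.comp_apply]
    _ = ∫ p, b (flip p) * v p ∂(ρ.map flip) := (integral_map flip.measurable.aemeasurable hbv).symm
    _ = ∫ p, b p * v p ∂ρ := by rw [hρ.map_eq, h b]

lemma flip_invariant_of_flipTest_invariant
    (hL : ∀ a b c, L (a, b, c) = ∫ p, a p ∂ρ + ∫ p, b p * v p ∂ρ + ∫ p, c p * g p ∂ρ)
    (h_inv : ∀ p, L (flipTest p) = L p) (hv : MemLp v 2 ρ) (hg : MemLp g 2 ρ) :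
    MeasurePreserving flip ρ ρ ∧ v ∘ flip =ᵐ[ρ] v ∧ g ∘ flip =ᵐ[ρ] g := by
  have hρ : MeasurePreserving flip ρ ρ := measurePreserving_flip fun a => by
    simpa [flipTest_apply, hL] using h_inv (a, 0, 0)
  refine ⟨hρ, comp_flip_ae_eq hρ hv fun b => ?_, comp_flip_ae_eq hρ hg fun c => ?_⟩
  · simpa [flipTest_apply, hL] using h_inv (0, b, 0)
  · simpa [flipTest_apply, hL] using h_inv (0, 0, c)

lemma energy_densityPath_le (hv : MemLp v 2 ρ) (hg : MemLp g 2 ρ)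
    (hE : ∫ p, (v p ^ 2 + δ ^ 2 * g p ^ 2) / 2 ∂ρ ≤ E) :
    energy δ (densityPath ρ v g) ≤ ENNReal.ofReal E := by
  have h_int : Integrable (fun p => (v p ^ 2 + δ ^ 2 * g p ^ 2) / 2) ρ :=
    (hv.integrable_sq.add (hg.integrable_sq.const_mul _)).div_const 2
  rw [energy_densityPath δ (hv.integrable one_le_two) (hg.integrable one_le_two),
    ← ofReal_integral_eq_lintegral_ofReal h_int (.of_forall fun p => by dsimp; positivity)]
  exact ENNReal.ofReal_le_ofReal hE

end Representation

lemma ofReal_le_wfrSq {δ E : ℝ} (hδ : δ ≠ 0) {ρ₀ ρ₁ : Measure Circle}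
    (hE : E ∈ lowerBounds {E | ∃ L, IsAdmissible δ E ρ₀ ρ₁ L}) :
    ENNReal.ofReal E ≤ wfrSq δ ρ₀ ρ₁ := by
  refine le_iInf₂ fun μ hμ => ?_
  by_cases hfin : energy δ μ = ∞
  · simp [hfin]
  · exact ENNReal.ofReal_le_of_le_toReal (hE (exists_isAdmissible_of_mem_CE hδ hμ hfin))

lemma disintegrates_slice {ρ : Measure (I × Circle)} [IsFiniteMeasure ρ] (hρ : ρ.fst ≪ volume) :
    Disintegrates ρ (slice ρ volume) :=
  ⟨inferInstance, inferInstance, (compProd_slice hρ).symm⟩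

lemma exists_symmetric_signedDisintegrates {ρ : Measure (I × Circle)} {κ : Kernel I Circle}
    (hκ : Disintegrates ρ κ) (κ_map : ∀ᵐ t, (κ t).map antipode = κ t) {v : I × Circle → ℝ}
    (hv : Measurable v) (hvi : Integrable v ρ) (v_flip : v ∘ flip =ᵐ[ρ] v) :
    ∃ st, SignedDisintegrates (ρ.withDensityᵥ v) st ∧ ∀ᵐ t, (st t).map antipode = st t := by
  refine ⟨_, signedDisintegrates_withDensityᵥ hκ hv hvi, ?_⟩
  obtain ⟨_, -, rfl⟩ := hκ
  exact ae_map_withDensityᵥ_eq measurable_antipode κ_map hvi v_flip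

end WFR

end

theorem lemma5p1 (δ : ℝ) (hδ : 0 < δ)
    (ρ₀ ρ₁ : Measure Circle) [IsFiniteMeasure ρ₀] [IsFiniteMeasure ρ₁]
    (h₀ : ρ₀.map WFR.antipode = ρ₀) (h₁ : ρ₁.map WFR.antipode = ρ₁) :
    ∃ μ : WFR.Path, WFR.IsMinimizer δ ρ₀ ρ₁ μ ∧
      ∃ (ρt : Kernel I Circle) (ωt ζt : I → SignedMeasure Circle),
        WFR.Disintegrates μ.ρ ρt ∧
        WFR.SignedDisintegrates μ.ω ωt ∧
        WFR.SignedDisintegrates μ.ζ ζt ∧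
        (∀ᵐ t : I, (ρt t).map WFR.antipode = ρt t ∧
          (ωt t).map WFR.antipode = ωt t ∧
          (ζt t).map WFR.antipode = ζt t) ∧
        (∀ᵐ t : I, ∫ x : Circle, (x : ℂ) ∂(ρt t) = 0) := by
  obtain ⟨E, ⟨L₀, hL₀⟩, E_le⟩ := WFR.exists_isLeast_isAdmissible hδ.ne'
    (WFR.exists_isAdmissible hδ.ne' ρ₀ ρ₁)
  obtain ⟨L, hL, L_flip⟩ := hL₀.exists_symmetric h₀ h₁
  obtain ⟨ρ, _, v, g, L_eq, energy_le⟩ := hL.exists_densities hδ.ne'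
  obtain ⟨ρ_flip, v_flip, g_flip⟩ :=
    WFR.flip_invariant_of_flipTest_invariant L_eq L_flip (Lp.memLp v) (Lp.memLp g)
  have hv : Integrable v ρ := (Lp.memLp v).integrable one_le_two
  have hg : Integrable g ρ := (Lp.memLp g).integrable one_le_two
  have mem_CE : WFR.densityPath ρ v g ∈ WFR.CE ρ₀ ρ₁ := WFR.densityPath_mem_CE hv hg fun hφ =>
    (L_eq _ _ _).symm.trans (hL.continuity hφ)
  have hρ : ρ.fst ≪ volume := WFR.fst_absolutelyContinuous mem_CE
  have slice_map := WFR.map_slice_ae_eq hρ WFR.measurable_antipode ρ_flip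
  have disintegrates := WFR.disintegrates_slice hρ
  obtain ⟨ωt, hωt, ωt_map⟩ := WFR.exists_symmetric_signedDisintegrates disintegrates slice_map
    (Lp.stronglyMeasurable v).measurable hv v_flip
  obtain ⟨ζt, hζt, ζt_map⟩ := WFR.exists_symmetric_signedDisintegrates disintegrates slice_map
    (Lp.stronglyMeasurable g).measurable hg g_flip
  have energy_le_wfrSq : WFR.energy δ (WFR.densityPath ρ v g) ≤ WFR.wfrSq δ ρ₀ ρ₁ :=
    (WFR.energy_densityPath_le (Lp.memLp v) (Lp.memLp g) energy_le).trans
      (WFR.ofReal_le_wfrSq hδ.ne' E_le)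
  exact ⟨WFR.densityPath ρ v g, ⟨mem_CE, energy_le_wfrSq.antisymm (iInf₂_le _ mem_CE)⟩,
    WFR.slice ρ volume, ωt, ζt, disintegrates, hωt, hζt,
    slice_map.and (ωt_map.and ζt_map), slice_map.mono fun t => WFR.integral_circle_eq_zero⟩
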